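/- Let $n\ge 1$. In the game $\Gamma_n(\theta)$ with parameter vector $\theta=(\alpha_1,\dots,\alpha_n,m)\in(0,1)^{n+1}$, each of $n$ students chooses an effort $x_i\in[0,1]$; with $\overline x=\frac1n\sum_j x_j$, the payoff of student $i$ is $$U_i(x;\theta)=\bigl(x_i+\max(m-\overline x,0)\bigr)^{\alpha_i}(1-x_i)^{1-\alpha_i}.$$ Write $BR_i(x_{-i};\theta)=\operatorname{argmax}_{x_i\in[0,1]}U_i(x_i,x_{-i};\theta)$. Profiles in $[0,1]^n$ are ordered coordinatewise. Monotonicity and $\le$ are weak throughout. 1. For every $\theta$, $i$ and $x_{-i}\in[0,1]^{n-1}$ the extremal best responses $\max BR_i(x_{-i};\theta)$ and $\min BR_i(x_{-i};\theta)$ exist, and there are a greatest and a least pure Nash equilibrium. All four are increasing in every ability parameter $\alpha_j$ and decreasing in the target mean $m$: if $\theta=(\alpha,m)$ and $\eta=(\beta,m')$ satisfy $\alpha\ge\beta$ and $m\le m'$, then each of these objects for $\theta$ is $\ge$ the corresponding one for $\eta$. 2. For every $\theta$, the set of pure Nash equilibria is totally (pre)ordered by Pareto preference: for any two equilibria, one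 of them gives every student at least as much utility as the other. The least (minimum-effort) equilibrium $x^*$ Pareto-dominates every equilibrium $x$, in the sense that $U_i(x^*;\theta)\ge U_i(x;\theta)$ for all $i$; moreover at least one of these inequalities is strict unless every $x_i$ is also a best response to $x^*_{-i}$. 3. For every $\theta$, the greatest and least pure Nash equilibria are, respectively, the greatest and least profiles of rationalizable strategies. Here an action of player $i$ is rationalizable if it belongs to $R_i$ for some sets $R_j\subseteq[0,1]$ ($1\le j\le n$) such that every $a\in R_j$ maximizes the expected payoff of $j$ under some probability distribution over opposing profiles that is concentrated on $\prod_{k\ne j}R_k$. They are likewise the greatest and least profiles of strategies that survive every finite number of rounds of deletion of strictly dominated strategies (where in each round the actions deleted are those that are strictly dominated by a pure action in $[0,1]$ against all surviving opposing profiles). 4. For every $\theta$, the sequence obtained by iterating $x\mapsto(\max BR_i(x_{-i};\theta))_{i}$ from $(1,\dots,1)$ converges to the greatest pure Nash equilibrium, and the sequence obtained by iterating $x\mapsto(\min BR_i(x_{-i};\theta))_{i}$ from $(0,\dots,0)$ converges to the least one. -/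

import Mathlib

open Set Filter Topology MeasureTheory

noncomputable section

namespace ExamCurve

/-- A point `(α₁, …, αₙ, m)` of the parameter space `Θ = (0,1)^(n+1)`: the students' ability
parameters and the target mean of the professor. -/
structure Params (n : ℕ) where
  /-- ability parameters -/
  ability : Fin n → ℝ
  /-- target mean -/
  target : ℝ
  ability_mem : ∀ i, ability i ∈ Ioo (0 : ℝ) 1
  target_mem : target ∈ Ioo (0 : ℝ) 1

variable {n : ℕ}

/-- `θ` is harder than `η`: larger (or equal) abilities and a smaller (or equal) target mean. -/
def HarderThan (θ η : Params n) : Prop :=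
  (∀ i, η.ability i ≤ θ.ability i) ∧ θ.target ≤ η.target

/-- The class average of an effort profile. -/
def classMean (x : Fin n → ℝ) : ℝ := (∑ i, x i) / n

/-- The curved grade of student `i`. -/
def grade (θ : Params n) (i : Fin n) (x : Fin n → ℝ) : ℝ :=
  x i + max (θ.target - classMean x) 0

/-- The Cobb-Douglas payoff of student `i`, from the curved grade and the leisure `1 - x i`. -/
def payoff (θ : Params n) (i : Fin n) (x : Fin n → ℝ) : ℝ :=
  grade θ i x ^ θ.ability i * (1 - x i) ^ (1 - θ.ability i)

/-- The cube `[0,1]ⁿ` of effort profiles. -/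
def profiles (n : ℕ) : Set (Fin n → ℝ) := {x | ∀ i, x i ∈ Icc (0 : ℝ) 1}

/-- The set of best responses of student `i` to the efforts of the others in `x`
(the entry `x i` plays no role). -/
def bestResponses (θ : Params n) (i : Fin n) (x : Fin n → ℝ) : Set ℝ :=
  {a | a ∈ Icc (0 : ℝ) 1 ∧ ∀ b ∈ Icc (0 : ℝ) 1,
    payoff θ i (Function.update x i b) ≤ payoff θ i (Function.update x i a)}

/-- The greatest best response. -/
def maxBR (θ : Params n) (i : Fin n) (x : Fin n → ℝ) : ℝ := sSup (bestResponses θ i x)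

/-- The least best response. -/
def minBR (θ : Params n) (i : Fin n) (x : Fin n → ℝ) : ℝ := sInf (bestResponses θ i x)

/-- All students simultaneously play their greatest best responses. -/
def maxReply (θ : Params n) (x : Fin n → ℝ) : Fin n → ℝ := fun i => maxBR θ i x

/-- All students simultaneously play their least best responses. -/
def minReply (θ : Params n) (x : Fin n → ℝ) : Fin n → ℝ := fun i => minBR θ i x

/-- The set of pure Nash equilibria. -/
def equilibria (θ : Params n) : Set (Fin n → ℝ) :=
  {x | ∀ i, x i ∈ bestResponses θ i x}

/-- `x` is Pareto-preferred to `y`: every student is at least as well off under `x`. -/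
def ParetoPreferred (θ : Params n) (x y : Fin n → ℝ) : Prop :=
  ∀ i, payoff θ i y ≤ payoff θ i x

/-- `x` strictly Pareto-dominates `y`: nobody is worse off and somebody is better off. -/
def StrictlyParetoDominates (θ : Params n) (x y : Fin n → ℝ) : Prop :=
  ParetoPreferred θ x y ∧ ∃ i, payoff θ i y < payoff θ i x

/-- A belief of student `i` concentrated on opposing efforts in the sets `R j`, `j ≠ i`: a
(possibly correlated) probability distribution. It is written as a law of whole profiles; its
`i`-th marginal never matters, since `i`'s own entry is always overwritten. -/
def IsBelief (i : Fin n) (R : Fin n → Set ℝ) (μ : Measure (Fin n → ℝ)) : Prop :=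
  IsProbabilityMeasure μ ∧ ∀ᵐ x ∂μ, ∀ j, j ≠ i → x j ∈ R j

/-- `a` maximizes the expected payoff of student `i` under the belief `μ`. -/
def IsBestResponseTo (θ : Params n) (i : Fin n) (μ : Measure (Fin n → ℝ)) (a : ℝ) : Prop :=
  a ∈ Icc (0 : ℝ) 1 ∧ ∀ b ∈ Icc (0 : ℝ) 1,
    ∫ x, payoff θ i (Function.update x i b) ∂μ ≤ ∫ x, payoff θ i (Function.update x i a) ∂μ

/-- The profiles of rationalizable strategies: each `x i` lies in the `i`-th member of a family of
action sets `R j` such that every action in `R j` is a best response of `j` to some belief that is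
concentrated on the sets of the other players. -/
def rationalizable (θ : Params n) : Set (Fin n → ℝ) :=
  {x | ∀ i, ∃ R : Fin n → Set ℝ, x i ∈ R i ∧ (∀ j, R j ⊆ Icc (0 : ℝ) 1) ∧
    ∀ j, ∀ a ∈ R j, ∃ μ, IsBelief j R μ ∧ IsBestResponseTo θ j μ a}

/-- The actions of each player that survive `k` rounds of deletion of the actions that are strictly
dominated by another pure action against all surviving opposing profiles. -/
def undominated (θ : Params n) : ℕ → Fin n → Set ℝ
  | 0 => fun _ => Icc (0 : ℝ) 1
  | k + 1 => fun i => {a | a ∈ undominated θ k i ∧ ¬ ∃ b ∈ Icc (0 : ℝ) 1,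
      ∀ x : Fin n → ℝ, (∀ j, j ≠ i → x j ∈ undominated θ k j) →
        payoff θ i (Function.update x i a) < payoff θ i (Function.update x i b)}

/-- The profiles of serially undominated strategies. -/
def seriallyUndominated (θ : Params n) : Set (Fin n → ℝ) :=
  {x | ∀ i, ∀ k, x i ∈ undominated θ k i}

end ExamCurve

end

namespace ExamCurve

/-! With c = 1 - 1/n, the grade of student `i` at effort `a` is max (c a + t) a. The slack `t`
carries all influence of the opponents and of the target mean: it falls when opponents work more and
rises with the target. The logarithm of the payoff has decreasing differences in (a, t) and
increasing differences in (a, ability). Payoffs can vanish, so `reducedPayoff_mul_le` states this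
multiplicatively. The resulting single crossing makes efforts strategic complements. Hence extremal
best replies are monotone, and iterating them from the top and bottom of the cube gives monotone
sequences whose limits are equilibria. The `k`-th iterates also bound all actions surviving `k`
deletion rounds (`undominated_subset_Icc`). As equilibria are rationalizable and rationalizable
profiles survive deletion, the two limits are extremal in all three sets. The Pareto order comes
from comparing class averages (`paretoPreferred_of_classMean_le`): more slack never hurts, and the
least equilibrium has the least average. -/

/-- The curved grade at own effort `a`, as a function of `t`, the target mean minus the part of the
class average contributed by the others; `c` stands for `1 - 1 / n`. -/
noncomputable def curvedGrade (c t a : ℝ) : ℝ := max (c * a + t) a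

/-- The payoff at own effort `a`, for ability `α`. -/
noncomputable def reducedPayoff (c α t a : ℝ) : ℝ := curvedGrade c t a ^ α * (1 - a) ^ (1 - α)

/-! ### Single crossing for one student's problem -/

section Reduced

variable {c α β s t a b : ℝ}

lemma le_curvedGrade : a ≤ curvedGrade c t a := le_max_right _ _

lemma curvedGrade_nonneg (ha : 0 ≤ a) : 0 ≤ curvedGrade c t a := ha.trans le_curvedGrade

lemma curvedGrade_mono_slack (hst : s ≤ t) : curvedGrade c s a ≤ curvedGrade c t a :=
  max_le_max (by linarith) le_rfl

lemma curvedGrade_mono (hc : 0 ≤ c) (hab : a ≤ b) : curvedGrade c s a ≤ curvedGrade c s b :=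
  max_le_max (by nlinarith) hab

/-- When the linear branch is taken in both factors on the left, the gap is at least c (b - a) (t -
s). The mixed branches need only monotonicity and, in one of them, t ≥ 0, which c ≤ 1 forces. -/
lemma curvedGrade_mul_le (hc : 0 ≤ c) (hc1 : c ≤ 1) (ha : 0 ≤ a) (hab : a ≤ b) (hst : s ≤ t) :
    curvedGrade c t b * curvedGrade c s a ≤ curvedGrade c t a * curvedGrade c s b := by
  have hb : 0 ≤ b := ha.trans hab
  have hta : c * a + t ≤ curvedGrade c t a := le_max_left _ _
  have hta' : a ≤ curvedGrade c t a := le_max_right _ _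
  have hsb : c * b + s ≤ curvedGrade c s b := le_max_left _ _
  have hsb' : b ≤ curvedGrade c s b := le_max_right _ _
  have hca : c * a ≤ c * b := mul_le_mul_of_nonneg_left hab hc
  rcases max_cases (c * b + t) b with ⟨h1, h1'⟩ | ⟨h1, h1'⟩ <;>
    rcases max_cases (c * a + s) a with ⟨h2, h2'⟩ | ⟨h2, h2'⟩ <;>
    rw [curvedGrade.eq_1 c t b, curvedGrade.eq_1 c s a, h1, h2]
  · have := mul_le_mul hta hsb (by linarith) (by linarith)
    nlinarith [mul_nonneg (mul_nonneg hc (sub_nonneg.2 hab)) (sub_nonneg.2 hst)]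
  · have ht : 0 ≤ t := by nlinarith
    have := mul_le_mul hta hsb' hb (by linarith)
    nlinarith
  · rw [mul_comm]
    exact mul_le_mul (by linarith) hsb' hb (by linarith)
  · rw [mul_comm]
    exact mul_le_mul hta' hsb' hb (by linarith)

lemma reducedPayoff_nonneg (ha : 0 ≤ a) (ha1 : a ≤ 1) : 0 ≤ reducedPayoff c α t a :=
  mul_nonneg (Real.rpow_nonneg (curvedGrade_nonneg ha) _) (Real.rpow_nonneg (by linarith) _)

lemma reducedPayoff_pos (hg : 0 < curvedGrade c t a) (ha1 : a < 1) : 0 < reducedPayoff c α t a :=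
  mul_pos (Real.rpow_pos_of_pos hg _) (Real.rpow_pos_of_pos (by linarith) _)

lemma pos_of_reducedPayoff_pos (hα : α ∈ Ioo (0 : ℝ) 1) (ha : a ∈ Icc (0 : ℝ) 1)
    (h : 0 < reducedPayoff c α t a) : 0 < curvedGrade c t a ∧ a < 1 := by
  constructor
  · refine (curvedGrade_nonneg ha.1).lt_of_ne fun h0 => h.ne' ?_
    rw [reducedPayoff, ← h0, Real.zero_rpow hα.1.ne', zero_mul]
  · refine ha.2.lt_of_ne fun h0 => h.ne' ?_
    rw [reducedPayoff, h0, sub_self, Real.zero_rpow (by linarith [hα.2]), mul_zero]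

lemma reducedPayoff_mono_slack (hα : 0 ≤ α) (ha : a ∈ Icc (0 : ℝ) 1) (hst : s ≤ t) :
    reducedPayoff c α s a ≤ reducedPayoff c α t a :=
  mul_le_mul_of_nonneg_right
    (Real.rpow_le_rpow (curvedGrade_nonneg ha.1) (curvedGrade_mono_slack hst) hα)
    (Real.rpow_nonneg (by linarith [ha.2]) _)

/-- Increasing differences of the logarithm of the payoff, in product form. -/
lemma reducedPayoff_mul_le (hc : 0 ≤ c) (hc1 : c ≤ 1) (hα : 0 ≤ α) (hαβ : α ≤ β) (hβ : β ≤ 1)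
    (ha : 0 ≤ a) (hab : a ≤ b) (hb : b ≤ 1) (hst : s ≤ t) :
    reducedPayoff c α t b * reducedPayoff c β s a ≤
      reducedPayoff c α t a * reducedPayoff c β s b := by
  have h1a : 0 ≤ 1 - a := by linarith
  have h1b : 0 ≤ 1 - b := by linarith
  have gta := curvedGrade_nonneg (c := c) (t := t) ha
  have gsa := curvedGrade_nonneg (c := c) (t := s) ha
  have gtb := curvedGrade_nonneg (c := c) (t := t) (ha.trans hab)
  have gsb := curvedGrade_nonneg (c := c) (t := s) (ha.trans hab)
  -- Both exponent splits isolate the power β - α. There the larger ability favours the larger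
  -- effort, since grade increases and leisure decreases in effort.
  have split : ∀ {g : ℝ}, 0 ≤ g → g ^ β = g ^ α * g ^ (β - α) := fun hg => by
    rw [← Real.rpow_add_of_nonneg hg hα (by linarith)]; congr 1; ring
  have split' : ∀ {g : ℝ}, 0 ≤ g → g ^ (1 - α) = g ^ (1 - β) * g ^ (β - α) := fun hg => by
    rw [← Real.rpow_add_of_nonneg hg (by linarith) (by linarith)]; congr 1; ring
  have e1 := Real.rpow_le_rpow (mul_nonneg gtb gsa) (curvedGrade_mul_le hc hc1 ha hab hst) hα
  rw [Real.mul_rpow gtb gsa, Real.mul_rpow gta gsb] at e1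
  have e2 := Real.rpow_le_rpow gsa (curvedGrade_mono (s := s) hc hab) (sub_nonneg.2 hαβ)
  have e3 := Real.rpow_le_rpow h1b (by linarith : 1 - b ≤ 1 - a) (sub_nonneg.2 hαβ)
  have e4 := mul_le_mul (mul_le_mul e1 e2 (by positivity) (by positivity)) e3
    (by positivity) (by positivity)
  have e5 := mul_le_mul_of_nonneg_right e4
    (mul_nonneg (Real.rpow_nonneg h1a (1 - β)) (Real.rpow_nonneg h1b (1 - β)))
  simp only [reducedPayoff]
  rw [split gsa, split gsb, split' h1a, split' h1b]
  linarith

/-- The product inequality is divided by the payoff of `a` at `s`. If that is zero, the payoff of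
`b` is still positive because 0 < b < 1. -/
lemma reducedPayoff_lt_of_harder (hc : 0 ≤ c) (hc1 : c ≤ 1) (hα : α ∈ Ioo (0 : ℝ) 1)
    (hβ : β ∈ Ioo (0 : ℝ) 1) (hαβ : α ≤ β) (ha : 0 ≤ a) (hab : a < b) (hb : b ≤ 1) (hst : s ≤ t)
    (h : reducedPayoff c α t a < reducedPayoff c α t b) :
    reducedPayoff c β s a < reducedPayoff c β s b := by
  have key := reducedPayoff_mul_le hc hc1 hα.1.le hαβ hβ.2.le ha hab.le hb hst
  have hta : 0 ≤ reducedPayoff c α t a := reducedPayoff_nonneg ha (by linarith)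
  have hsa : 0 ≤ reducedPayoff c β s a := reducedPayoff_nonneg ha (by linarith)
  have hb1 := (pos_of_reducedPayoff_pos hα ⟨by linarith, hb⟩ (hta.trans_lt h)).2
  have hsb : 0 < reducedPayoff c β s b :=
    reducedPayoff_pos ((ha.trans_lt hab).trans_le le_curvedGrade) hb1
  rcases hsa.eq_or_lt with h0 | h0
  · rwa [← h0]
  · have := mul_lt_mul_of_pos_right h h0
    exact lt_of_mul_lt_mul_left (this.trans_le key) hta

/-- Here the divisor is the payoff of `b` at `t`. If it vanishes, as at b = 1, the payoff of `a`
remains positive because extra slack only raises the grade. -/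
lemma reducedPayoff_lt_of_easier (hc : 0 ≤ c) (hc1 : c ≤ 1) (hα : α ∈ Ioo (0 : ℝ) 1)
    (hβ : β ∈ Ioo (0 : ℝ) 1) (hαβ : α ≤ β) (ha : 0 ≤ a) (hab : a < b) (hb : b ≤ 1) (hst : s ≤ t)
    (h : reducedPayoff c β s b < reducedPayoff c β s a) :
    reducedPayoff c α t b < reducedPayoff c α t a := by
  have key := reducedPayoff_mul_le hc hc1 hα.1.le hαβ hβ.2.le ha hab.le hb hst
  have htb : 0 ≤ reducedPayoff c α t b := reducedPayoff_nonneg (by linarith) hb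
  have hsb : 0 ≤ reducedPayoff c β s b := reducedPayoff_nonneg (by linarith) hb
  have hsa := pos_of_reducedPayoff_pos hβ ⟨ha, by linarith⟩ (hsb.trans_lt h)
  have hta : 0 < reducedPayoff c α t a :=
    reducedPayoff_pos (hsa.1.trans_le (curvedGrade_mono_slack hst)) hsa.2
  rcases htb.eq_or_lt with h0 | h0
  · rwa [← h0]
  · have := mul_lt_mul_of_pos_left h h0
    exact lt_of_mul_lt_mul_right (this.trans_le key) hsb

/-- Where the curve is active, increasing differences are strict. -/
lemma reducedPayoff_mul_lt (hc : 0 < c) (hα : 0 < α) (ha : 0 ≤ a) (hab : a < b) (hb : b < 1)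
    (hst : s < t) (hs : a ≤ c * a + s) (ht : b ≤ c * b + t) (hta : a ≤ c * a + t) :
    reducedPayoff c α t b * reducedPayoff c α s a <
      reducedPayoff c α t a * reducedPayoff c α s b := by
  have gta := curvedGrade_nonneg (c := c) (t := t) ha
  have gsa := curvedGrade_nonneg (c := c) (t := s) ha
  have gtb := curvedGrade_nonneg (c := c) (t := t) (ha.trans hab.le)
  have gsb := curvedGrade_nonneg (c := c) (t := s) (ha.trans hab.le)
  have hg : curvedGrade c t b * curvedGrade c s a < curvedGrade c t a * curvedGrade c s b := by
    rw [curvedGrade.eq_1 c t b, curvedGrade.eq_1 c s a, curvedGrade.eq_1 c t a, max_eq_left ht,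
      max_eq_left hs, max_eq_left hta]
    have h1 : c * b + s ≤ curvedGrade c s b := le_max_left _ _
    have h2 := mul_le_mul_of_nonneg_left h1 (ha.trans hta)
    nlinarith [mul_pos (mul_pos hc (sub_pos.2 hab)) (sub_pos.2 hst)]
  have e1 := Real.rpow_lt_rpow (mul_nonneg gtb gsa) hg hα
  rw [Real.mul_rpow gtb gsa, Real.mul_rpow gta gsb] at e1
  have e2 := mul_lt_mul_of_pos_right e1 (mul_pos
    (Real.rpow_pos_of_pos (by linarith : 0 < 1 - a) (1 - α))
    (Real.rpow_pos_of_pos (by linarith : 0 < 1 - b) (1 - α)))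
  simp only [reducedPayoff]
  linarith

end Reduced

variable {n : ℕ}

/-! ### Reduction of the game to slacks -/

/-- The target mean minus the part of the class average contributed by the opponents of `i`. -/
noncomputable def slack (θ : Params n) (i : Fin n) (x : Fin n → ℝ) : ℝ :=
  θ.target - (∑ j ∈ Finset.univ \ {i}, x j) / n

/-- The weight of the own effort in the curved grade. -/
noncomputable def ownWeight (n : ℕ) : ℝ := 1 - 1 / n

lemma ownWeight_nonneg (n : ℕ) : 0 ≤ ownWeight n := by
  have := Nat.cast_inv_le_one (α := ℝ) n
  rw [ownWeight, one_div]
  linarith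

lemma ownWeight_le_one (n : ℕ) : ownWeight n ≤ 1 :=
  sub_le_self _ (by positivity)

lemma payoff_update (θ : Params n) (i : Fin n) (x : Fin n → ℝ) (a : ℝ) :
    payoff θ i (Function.update x i a) =
      reducedPayoff (ownWeight n) (θ.ability i) (slack θ i x) a := by
  have hg : grade θ i (Function.update x i a) = curvedGrade (ownWeight n) (slack θ i x) a := by
    rw [grade, classMean, Finset.sum_update_of_mem (Finset.mem_univ i), Function.update_self,
      ← max_add_add_left, add_zero, curvedGrade, slack, ownWeight]
    congr 1
    ring
  rw [payoff, hg, Function.update_self, reducedPayoff]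

lemma payoff_eq_reducedPayoff (θ : Params n) (i : Fin n) (x : Fin n → ℝ) :
    payoff θ i x = reducedPayoff (ownWeight n) (θ.ability i) (slack θ i x) (x i) := by
  rw [← payoff_update, Function.update_eq_self]

lemma slack_le_slack {θ η : Params n} (h : θ.target ≤ η.target) {i : Fin n} {x y : Fin n → ℝ}
    (hxy : ∀ j, j ≠ i → x j ≤ y j) : slack θ i y ≤ slack η i x := by
  refine sub_le_sub h (div_le_div_of_nonneg_right (Finset.sum_le_sum fun j hj => hxy j ?_)
    n.cast_nonneg)
  simpa using hj

lemma payoff_lt_of_harder {θ η : Params n} (h : HarderThan θ η) {i : Fin n} {x y : Fin n → ℝ}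
    (hxy : ∀ j, j ≠ i → x j ≤ y j) {a b : ℝ} (ha : 0 ≤ a) (hab : a < b) (hb : b ≤ 1)
    (hlt : payoff η i (Function.update x i a) < payoff η i (Function.update x i b)) :
    payoff θ i (Function.update y i a) < payoff θ i (Function.update y i b) := by
  rw [payoff_update, payoff_update] at *
  exact reducedPayoff_lt_of_harder (ownWeight_nonneg n) (ownWeight_le_one n) (η.ability_mem i)
    (θ.ability_mem i) (h.1 i) ha hab hb (slack_le_slack h.2 hxy) hlt

lemma payoff_lt_of_easier {θ η : Params n} (h : HarderThan θ η) {i : Fin n} {x y : Fin n → ℝ}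
    (hxy : ∀ j, j ≠ i → x j ≤ y j) {a b : ℝ} (ha : 0 ≤ a) (hab : a < b) (hb : b ≤ 1)
    (hlt : payoff θ i (Function.update y i b) < payoff θ i (Function.update y i a)) :
    payoff η i (Function.update x i b) < payoff η i (Function.update x i a) := by
  rw [payoff_update, payoff_update] at *
  exact reducedPayoff_lt_of_easier (ownWeight_nonneg n) (ownWeight_le_one n) (η.ability_mem i)
    (θ.ability_mem i) (h.1 i) ha hab hb (slack_le_slack h.2 hxy) hlt

lemma HarderThan.refl (θ : Params n) : HarderThan θ θ := ⟨fun _ => le_rfl, le_rfl⟩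

/-! ### Extremal best responses and their monotonicity -/

lemma continuous_payoff (θ : Params n) (i : Fin n) : Continuous (payoff θ i) := by
  have h0 := θ.ability_mem i
  unfold payoff grade classMean
  refine Continuous.mul (Continuous.rpow_const (by fun_prop) fun _ => Or.inr h0.1.le)
    (Continuous.rpow_const (by fun_prop) fun _ => Or.inr (by linarith [h0.2]))

lemma bestResponses_nonempty (θ : Params n) (i : Fin n) (x : Fin n → ℝ) :
    (bestResponses θ i x).Nonempty := by
  obtain ⟨a, ha, hmax⟩ := (isCompact_Icc (a := (0 : ℝ)) (b := 1)).exists_isMaxOn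
    (nonempty_Icc.2 zero_le_one)
    ((continuous_payoff θ i).comp (continuous_const.update i continuous_id :
      Continuous fun a : ℝ => Function.update x i a)).continuousOn
  exact ⟨a, ha, fun b hb => hmax hb⟩

lemma isCompact_bestResponses (θ : Params n) (i : Fin n) (x : Fin n → ℝ) :
    IsCompact (bestResponses θ i x) := by
  refine isCompact_Icc.of_isClosed_subset (s := Icc (0 : ℝ) 1) ?_ fun a ha => ha.1
  have hc : Continuous fun a : ℝ => payoff θ i (Function.update x i a) :=
    (continuous_payoff θ i).comp (continuous_const.update i continuous_id)
  simp only [bestResponses, ofPred_and, ofPred_forall]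
  exact isClosed_Icc.inter (isClosed_iInter fun b => isClosed_iInter fun _ =>
    isClosed_le continuous_const hc)

lemma isGreatest_maxBR (θ : Params n) (i : Fin n) (x : Fin n → ℝ) :
    IsGreatest (bestResponses θ i x) (maxBR θ i x) :=
  (isCompact_bestResponses θ i x).isGreatest_sSup (bestResponses_nonempty θ i x)

lemma isLeast_minBR (θ : Params n) (i : Fin n) (x : Fin n → ℝ) :
    IsLeast (bestResponses θ i x) (minBR θ i x) :=
  (isCompact_bestResponses θ i x).isLeast_sInf (bestResponses_nonempty θ i x)

lemma payoff_lt_of_notMem_bestResponses {θ : Params n} {i : Fin n} {x : Fin n → ℝ} {a b : ℝ}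
    (ha : a ∈ Icc (0 : ℝ) 1) (ha' : a ∉ bestResponses θ i x) (hb : b ∈ bestResponses θ i x) :
    payoff θ i (Function.update x i a) < payoff θ i (Function.update x i b) := by
  by_contra! h
  exact ha' ⟨ha, fun d hd => (hb.2 d hd).trans h⟩

/-- An action above the greatest best response to `y` does strictly worse than it against every
profile below `y`, in every easier game. -/
lemma payoff_lt_payoff_maxBR {θ η : Params n} (h : HarderThan θ η) {i : Fin n}
    {x y : Fin n → ℝ} (hxy : ∀ j, j ≠ i → x j ≤ y j) {a : ℝ} (ha : a ≤ 1)
    (hlt : maxBR θ i y < a) :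
    payoff η i (Function.update x i a) < payoff η i (Function.update x i (maxBR θ i y)) := by
  have hM := isGreatest_maxBR θ i y
  have h0 := hM.1.1.1
  exact payoff_lt_of_easier h hxy h0 hlt ha (payoff_lt_of_notMem_bestResponses ⟨by linarith, ha⟩
    (fun hmem => hlt.not_ge (hM.2 hmem)) hM.1)

lemma payoff_lt_payoff_minBR {θ η : Params n} (h : HarderThan θ η) {i : Fin n}
    {x y : Fin n → ℝ} (hxy : ∀ j, j ≠ i → x j ≤ y j) {a : ℝ} (ha : 0 ≤ a)
    (hlt : a < minBR η i x) :
    payoff θ i (Function.update y i a) < payoff θ i (Function.update y i (minBR η i x)) := by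
  have hM := isLeast_minBR η i x
  have h1 := hM.1.1.2
  exact payoff_lt_of_harder h hxy ha hlt h1 (payoff_lt_of_notMem_bestResponses ⟨ha, by linarith⟩
    (fun hmem => hlt.not_ge (hM.2 hmem)) hM.1)

lemma maxBR_mono {θ η : Params n} (h : HarderThan θ η) (i : Fin n) {x y : Fin n → ℝ}
    (hxy : x ≤ y) : maxBR η i x ≤ maxBR θ i y := by
  by_contra! hlt
  have hM := (isGreatest_maxBR η i x).1
  exact (payoff_lt_payoff_maxBR h (fun j _ => hxy j) hM.1.2 hlt).not_ge
    (hM.2 _ (isGreatest_maxBR θ i y).1.1)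

lemma minBR_mono {θ η : Params n} (h : HarderThan θ η) (i : Fin n) {x y : Fin n → ℝ}
    (hxy : x ≤ y) : minBR η i x ≤ minBR θ i y := by
  by_contra! hlt
  have hM := (isLeast_minBR θ i y).1
  exact (payoff_lt_payoff_minBR h (fun j _ => hxy j) hM.1.1 hlt).not_ge
    (hM.2 _ (isLeast_minBR η i x).1.1)

lemma maxReply_monotone (θ : Params n) : Monotone (maxReply θ) :=
  fun _ _ hxy i => maxBR_mono (.refl θ) i hxy

lemma minReply_monotone (θ : Params n) : Monotone (minReply θ) :=
  fun _ _ hxy i => minBR_mono (.refl θ) i hxy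

/-- A limit of a sequence of successive best replies is an equilibrium. -/
lemma mem_equilibria_of_tendsto {θ : Params n} {u : ℕ → Fin n → ℝ} {z : Fin n → ℝ}
    (hu : Tendsto u atTop (𝓝 z)) (hbr : ∀ k i, u (k + 1) i ∈ bestResponses θ i (u k)) :
    z ∈ equilibria θ := by
  intro i
  have hi : Tendsto (fun k => u (k + 1) i) atTop (𝓝 (z i)) :=
    (tendsto_pi_nhds.1 hu i).comp (tendsto_add_atTop_nat 1)
  refine ⟨isClosed_Icc.mem_of_tendsto hi (.of_forall fun k => (hbr k i).1), fun b hb => ?_⟩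
  exact le_of_tendsto_of_tendsto'
    (((continuous_payoff θ i).tendsto _).comp (hu.update i tendsto_const_nhds))
    (((continuous_payoff θ i).tendsto _).comp (hu.update i hi))
    fun k => (hbr k i).2 b hb

/-! ### Iterated extremal replies -/

/-- Iterated greatest replies from the top. -/
noncomputable def maxSeq (θ : Params n) (k : ℕ) : Fin n → ℝ := (maxReply θ)^[k] fun _ => 1

/-- Iterated least replies from the bottom. -/
noncomputable def minSeq (θ : Params n) (k : ℕ) : Fin n → ℝ := (minReply θ)^[k] fun _ => 0

lemma maxSeq_succ (θ : Params n) (k : ℕ) : maxSeq θ (k + 1) = maxReply θ (maxSeq θ k) :=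
  Function.iterate_succ_apply' _ _ _

lemma minSeq_succ (θ : Params n) (k : ℕ) : minSeq θ (k + 1) = minReply θ (minSeq θ k) :=
  Function.iterate_succ_apply' _ _ _

lemma antitone_maxSeq (θ : Params n) : Antitone (maxSeq θ) :=
  (maxReply_monotone θ).antitone_iterate_of_map_le fun i => (isGreatest_maxBR θ i _).1.1.2

lemma monotone_minSeq (θ : Params n) : Monotone (minSeq θ) :=
  (minReply_monotone θ).monotone_iterate_of_le_map fun i => (isLeast_minBR θ i _).1.1.1

lemma maxSeq_nonneg (θ : Params n) (k : ℕ) (i : Fin n) : 0 ≤ maxSeq θ k i := by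
  cases k with
  | zero => exact zero_le_one
  | succ k => rw [maxSeq_succ]; exact (isGreatest_maxBR θ i _).1.1.1

lemma minSeq_le_one (θ : Params n) (k : ℕ) (i : Fin n) : minSeq θ k i ≤ 1 := by
  cases k with
  | zero => exact zero_le_one
  | succ k => rw [minSeq_succ]; exact (isLeast_minBR θ i _).1.1.2

lemma exists_tendsto_maxSeq (θ : Params n) :
    ∃ z ∈ equilibria θ, Tendsto (maxSeq θ) atTop (𝓝 z) := by
  have h : Tendsto (maxSeq θ) atTop (𝓝 fun i => ⨅ k, maxSeq θ k i) :=
    tendsto_pi_nhds.2 fun i => tendsto_atTop_ciInf (fun k l hkl => antitone_maxSeq θ hkl i)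
      ⟨0, by rintro _ ⟨k, rfl⟩; exact maxSeq_nonneg θ k i⟩
  exact ⟨_, mem_equilibria_of_tendsto h fun k i => by
    rw [maxSeq_succ]; exact (isGreatest_maxBR θ i _).1, h⟩

lemma exists_tendsto_minSeq (θ : Params n) :
    ∃ z ∈ equilibria θ, Tendsto (minSeq θ) atTop (𝓝 z) := by
  have h : Tendsto (minSeq θ) atTop (𝓝 fun i => ⨆ k, minSeq θ k i) :=
    tendsto_pi_nhds.2 fun i => tendsto_atTop_ciSup (fun k l hkl => monotone_minSeq θ hkl i)
      ⟨1, by rintro _ ⟨k, rfl⟩; exact minSeq_le_one θ k i⟩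
  exact ⟨_, mem_equilibria_of_tendsto h fun k i => by
    rw [minSeq_succ]; exact (isLeast_minBR θ i _).1, h⟩

lemma maxSeq_le_maxSeq {θ η : Params n} (h : HarderThan θ η) (k : ℕ) :
    maxSeq η k ≤ maxSeq θ k := by
  induction k with
  | zero => exact le_rfl
  | succ k ih => rw [maxSeq_succ, maxSeq_succ]; exact fun i => maxBR_mono h i ih

lemma minSeq_le_minSeq {θ η : Params n} (h : HarderThan θ η) (k : ℕ) :
    minSeq η k ≤ minSeq θ k := by
  induction k with
  | zero => exact le_rfl
  | succ k ih => rw [minSeq_succ, minSeq_succ]; exact fun i => minBR_mono h i ih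

/-! ### Dominance and rationalizability -/

lemma undominated_subset_Icc_zero_one (θ : Params n) (k : ℕ) (i : Fin n) :
    undominated θ k i ⊆ Icc 0 1 := by
  induction k with
  | zero => exact subset_rfl
  | succ k ih => exact fun a ha => ih ha.1

/-- Against opponents below `maxSeq θ k`, any action above the greatest reply to `maxSeq θ k` is
strictly dominated by that one reply; dually from below. -/
lemma undominated_subset_Icc (θ : Params n) (k : ℕ) (i : Fin n) :
    undominated θ k i ⊆ Icc (minSeq θ k i) (maxSeq θ k i) := by
  induction k generalizing i with
  | zero => exact subset_rfl
  | succ k ih =>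
    intro a ha
    have ha01 := undominated_subset_Icc_zero_one θ _ _ ha
    constructor
    · by_contra! hlt
      rw [minSeq_succ] at hlt
      exact ha.2 ⟨_, (isLeast_minBR θ i _).1.1, fun x hx =>
        payoff_lt_payoff_minBR (.refl θ) (fun j hj => (ih j (hx j hj)).1) ha01.1 hlt⟩
    · by_contra! hlt
      rw [maxSeq_succ] at hlt
      exact ha.2 ⟨_, (isGreatest_maxBR θ i _).1.1, fun x hx =>
        payoff_lt_payoff_maxBR (.refl θ) (fun j hj => (ih j (hx j hj)).2) ha01.2 hlt⟩

lemma equilibria_subset_rationalizable (θ : Params n) : equilibria θ ⊆ rationalizable θ := by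
  refine fun x hx i => ⟨fun j => {x j}, rfl, fun j => singleton_subset_iff.2 (hx j).1, ?_⟩
  rintro j _ rfl
  refine ⟨Measure.dirac x, ⟨inferInstance, ?_⟩, (hx j).1, fun b hb => ?_⟩
  · rw [ae_dirac_eq]
    exact fun k _ => rfl
  · rw [integral_dirac, integral_dirac]
    exact (hx j).2 b hb

lemma isCompact_profiles (n : ℕ) : IsCompact (profiles n) := by
  have : profiles n = univ.pi fun _ : Fin n => Icc (0 : ℝ) 1 := by
    ext x
    simp only [profiles, mem_ofPred_eq, mem_univ_pi]
  rw [this]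
  exact isCompact_univ_pi fun _ => isCompact_Icc

lemma integrable_payoff_update (θ : Params n) {i : Fin n} {R : Fin n → Set ℝ}
    (hR : ∀ j, R j ⊆ Icc 0 1) {μ : Measure (Fin n → ℝ)} (hμ : IsBelief i R μ) {a : ℝ}
    (ha : a ∈ Icc (0 : ℝ) 1) : Integrable (fun x => payoff θ i (Function.update x i a)) μ := by
  obtain ⟨hprob, hae⟩ := hμ
  obtain ⟨C, hC⟩ :=
    (isCompact_profiles n).exists_bound_of_continuousOn (continuous_payoff θ i).continuousOn
  have hcont : Continuous fun x : Fin n → ℝ => payoff θ i (Function.update x i a) :=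
    (continuous_payoff θ i).comp (continuous_id.update i continuous_const)
  refine Integrable.of_bound hcont.aestronglyMeasurable C ?_
  filter_upwards [hae] with x hx
  refine hC _ fun j => ?_
  rcases eq_or_ne j i with rfl | hj
  · rwa [Function.update_self]
  · rw [Function.update_of_ne hj]
    exact hR j (hx j hj)

lemma rationalizable_subset_seriallyUndominated (θ : Params n) :
    rationalizable θ ⊆ seriallyUndominated θ := by
  intro x hx i k
  obtain ⟨R, hxR, hR, hbr⟩ := hx i
  suffices h : ∀ j, R j ⊆ undominated θ k j from h i hxR
  clear hxR
  induction k with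
  | zero => exact hR
  | succ k ih =>
    refine fun j a ha => ⟨ih j ha, ?_⟩
    rintro ⟨b, hb, hdom⟩
    obtain ⟨μ, hμ, ha01, hmax⟩ := hbr j a ha
    have hprob := hμ.1
    refine (hmax b hb).not_gt ?_
    have hia := integrable_payoff_update θ hR hμ ha01
    have hib := integrable_payoff_update θ hR hμ hb
    have hlt : ∀ᵐ y ∂μ, payoff θ j (Function.update y j a) < payoff θ j (Function.update y j b) := by
      filter_upwards [hμ.2] with y hy using hdom y fun l hl => ih l (hy l hl)
    -- Equal integrals would force almost sure equality, contradicting the almost sure strict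
    -- inequality since a probability measure is nonzero.
    refine (integral_mono_ae hia hib (hlt.mono fun _ h => h.le)).lt_of_ne fun heq => ?_
    have := (integral_eq_iff_of_ae_le hia hib (hlt.mono fun _ h => h.le)).1 heq
    obtain ⟨y, hy, hy'⟩ := (hlt.and this).exists
    exact hy.ne hy'

lemma equilibria_subset_seriallyUndominated (θ : Params n) :
    equilibria θ ⊆ seriallyUndominated θ :=
  (equilibria_subset_rationalizable θ).trans (rationalizable_subset_seriallyUndominated θ)

lemma le_of_tendsto_maxSeq {θ : Params n} {x z : Fin n → ℝ} (hx : x ∈ seriallyUndominated θ)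
    (hz : Tendsto (maxSeq θ) atTop (𝓝 z)) : x ≤ z :=
  ge_of_tendsto' hz fun k i => (undominated_subset_Icc θ k i (hx i k)).2

lemma ge_of_tendsto_minSeq {θ : Params n} {x z : Fin n → ℝ} (hx : x ∈ seriallyUndominated θ)
    (hz : Tendsto (minSeq θ) atTop (𝓝 z)) : z ≤ x :=
  le_of_tendsto' hz fun k i => (undominated_subset_Icc θ k i (hx i k)).1

/-! ### Pareto comparison of equilibria -/

lemma slack_eq (θ : Params n) (i : Fin n) (x : Fin n → ℝ) :
    slack θ i x = θ.target - classMean x + x i / n := by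
  have h := Finset.sum_sdiff (f := x) (Finset.subset_univ {i})
  rw [Finset.sum_singleton] at h
  rw [slack, classMean, ← h]
  ring

/-- No student's equilibrium effort is `1`. -/
lemma lt_one_of_mem_bestResponses {θ : Params n} {i : Fin n} {x : Fin n → ℝ} {a : ℝ}
    (ha : a ∈ bestResponses θ i x) : a < 1 := by
  -- Effort 1 earns zero, while any interior effort such as 1/2 earns a positive payoff.
  have h := ha.2 (1 / 2) ⟨by norm_num, by norm_num⟩
  rw [payoff_update, payoff_update] at h
  have hpos : 0 < reducedPayoff (ownWeight n) (θ.ability i) (slack θ i x) (1 / 2) :=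
    reducedPayoff_pos (lt_of_lt_of_le (by norm_num) le_curvedGrade) (by norm_num)
  exact (pos_of_reducedPayoff_pos (θ.ability_mem i) ha.1 (hpos.trans_le h)).2

/-- Among equilibria, a lower class average is better for everybody. -/
lemma paretoPreferred_of_classMean_le {θ : Params n} {x y : Fin n → ℝ} (hx : x ∈ equilibria θ)
    (hy : y ∈ equilibria θ) (hxy : classMean x ≤ classMean y) : ParetoPreferred θ x y := by
  intro i
  have hα := θ.ability_mem i
  have hxi := (hx i).1
  have hyi := (hy i).1
  have hx1 := (hx i).2 _ hyi
  have hy1 := (hy i).2 _ hxi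
  rw [payoff_update, payoff_update] at hx1 hy1
  rw [payoff_eq_reducedPayoff, payoff_eq_reducedPayoff]
  rcases le_or_gt (slack θ i y) (slack θ i x) with hs | hs
  · exact (reducedPayoff_mono_slack hα.1.le hyi hs).trans hx1
  have hn : (0 : ℝ) < n := by exact_mod_cast i.pos
  have hsx := slack_eq θ i x
  have hsy := slack_eq θ i y
  have hlt : x i / n < y i / n := by linarith
  have hlt' : x i < y i := (div_lt_div_iff_of_pos_right hn).1 hlt
  have hw : ∀ z : ℝ, ownWeight n * z = z - z / n := fun z => by rw [ownWeight]; ring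
  -- If the curve adds nothing at `y`, it adds nothing to effort `y i` under the smaller slack of
  -- `x` either, so `y i` is worth the same against both profiles.
  rcases le_or_gt θ.target (classMean y) with hm | hm
  · refine le_trans (le_of_eq ?_) hx1
    have h1 : curvedGrade (ownWeight n) (slack θ i y) (y i) = y i :=
      max_eq_right (by rw [hw]; linarith)
    have h2 : curvedGrade (ownWeight n) (slack θ i x) (y i) = y i :=
      max_eq_right (by rw [hw]; linarith)
    rw [reducedPayoff, reducedPayoff, h1, h2]
  -- The curve is now active at both equilibria. Strict differences say that more slack favours the
  -- lower effort, yet `y i` exceeds `x i` and is optimal at the larger slack.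
  · exfalso
    -- Zero weight means n = 1; without opponents the two slacks coincide.
    have hw0 : 0 < ownWeight n := by
      refine (ownWeight_nonneg n).lt_of_ne fun h0 => hs.ne ?_
      have h1 : (n : ℝ) = 1 := by
        rw [ownWeight] at h0
        field_simp at h0
        linarith
      have h2 : n = 1 := by exact_mod_cast h1
      subst h2
      have : Finset.univ \ {i} = (∅ : Finset (Fin 1)) := by
        ext j
        simp [Subsingleton.elim j i]
      rw [slack, slack, this, Finset.sum_empty, Finset.sum_empty]
    have key := reducedPayoff_mul_lt hw0 hα.1 hxi.1 hlt'
      (lt_one_of_mem_bestResponses (hy i)) hs (by rw [hw]; linarith) (by rw [hw]; linarith)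
      (by rw [hw]; linarith)
    refine key.not_ge (mul_le_mul hy1 hx1 ?_ ?_) <;>
      exact reducedPayoff_nonneg hyi.1 hyi.2

end ExamCurve

theorem mainTheorem10 (n : ℕ) (hn : 1 ≤ n) :
    -- extremal best responses exist
    (∀ (θ : ExamCurve.Params n) (i : Fin n), ∀ x ∈ ExamCurve.profiles n,
      IsGreatest (ExamCurve.bestResponses θ i x) (ExamCurve.maxBR θ i x) ∧
      IsLeast (ExamCurve.bestResponses θ i x) (ExamCurve.minBR θ i x)) ∧
    -- extremal best responses and extremal equilibria increase with hardness
    (∀ θ η : ExamCurve.Params n, ExamCurve.HarderThan θ η →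
      (∀ (i : Fin n), ∀ x ∈ ExamCurve.profiles n,
        ExamCurve.maxBR η i x ≤ ExamCurve.maxBR θ i x ∧
        ExamCurve.minBR η i x ≤ ExamCurve.minBR θ i x) ∧
      (∀ y y' : Fin n → ℝ, IsGreatest (ExamCurve.equilibria η) y →
        IsGreatest (ExamCurve.equilibria θ) y' → y ≤ y') ∧
      (∀ x x' : Fin n → ℝ, IsLeast (ExamCurve.equilibria η) x →
        IsLeast (ExamCurve.equilibria θ) x' → x ≤ x')) ∧
    -- structure of the equilibria of a given model
    (∀ θ : ExamCurve.Params n, ∃ lo hi : Fin n → ℝ,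
      IsLeast (ExamCurve.equilibria θ) lo ∧ IsGreatest (ExamCurve.equilibria θ) hi ∧
      (∀ x ∈ ExamCurve.equilibria θ, ∀ y ∈ ExamCurve.equilibria θ,
        ExamCurve.ParetoPreferred θ x y ∨ ExamCurve.ParetoPreferred θ y x) ∧
      (∀ x ∈ ExamCurve.equilibria θ, ExamCurve.ParetoPreferred θ lo x ∧
        ((∃ i, x i ∉ ExamCurve.bestResponses θ i lo) →
          ExamCurve.StrictlyParetoDominates θ lo x)) ∧
      IsLeast (ExamCurve.rationalizable θ) lo ∧ IsGreatest (ExamCurve.rationalizable θ) hi ∧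
      IsLeast (ExamCurve.seriallyUndominated θ) lo ∧
      IsGreatest (ExamCurve.seriallyUndominated θ) hi ∧
      Tendsto (fun t : ℕ => (ExamCurve.maxReply θ)^[t] (fun _ => 1)) atTop (𝓝 hi) ∧
      Tendsto (fun t : ℕ => (ExamCurve.minReply θ)^[t] (fun _ => 0)) atTop (𝓝 lo)) := by
  refine ⟨fun θ i x _ => ⟨ExamCurve.isGreatest_maxBR θ i x, ExamCurve.isLeast_minBR θ i x⟩,
    fun θ η h => ⟨fun i x _ => ⟨ExamCurve.maxBR_mono h i le_rfl, ExamCurve.minBR_mono h i le_rfl⟩,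
      ?_, ?_⟩, fun θ => ?_⟩
  · intro y y' hy hy'
    obtain ⟨z, hz, hzt⟩ := ExamCurve.exists_tendsto_maxSeq η
    obtain ⟨z', hz', hzt'⟩ := ExamCurve.exists_tendsto_maxSeq θ
    exact (ExamCurve.le_of_tendsto_maxSeq
      (ExamCurve.equilibria_subset_seriallyUndominated η hy.1) hzt).trans
      ((le_of_tendsto_of_tendsto' hzt hzt' (ExamCurve.maxSeq_le_maxSeq h)).trans (hy'.2 hz'))
  · intro x x' hx hx'
    obtain ⟨z, hz, hzt⟩ := ExamCurve.exists_tendsto_minSeq η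
    obtain ⟨z', hz', hzt'⟩ := ExamCurve.exists_tendsto_minSeq θ
    exact (hx.2 hz).trans ((le_of_tendsto_of_tendsto' hzt hzt'
      (ExamCurve.minSeq_le_minSeq h)).trans (ExamCurve.ge_of_tendsto_minSeq
      (ExamCurve.equilibria_subset_seriallyUndominated θ hx'.1) hzt'))
  · obtain ⟨hi, hhi, hhit⟩ := ExamCurve.exists_tendsto_maxSeq θ
    obtain ⟨lo, hlo, hlot⟩ := ExamCurve.exists_tendsto_minSeq θ
    have hsu := ExamCurve.equilibria_subset_seriallyUndominated θ
    have hrat := ExamCurve.equilibria_subset_rationalizable θ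
    have hratsu := ExamCurve.rationalizable_subset_seriallyUndominated θ
    have hup : hi ∈ upperBounds (ExamCurve.seriallyUndominated θ) :=
      fun x hx => ExamCurve.le_of_tendsto_maxSeq hx hhit
    have hdown : lo ∈ lowerBounds (ExamCurve.seriallyUndominated θ) :=
      fun x hx => ExamCurve.ge_of_tendsto_minSeq hx hlot
    have hpar : ∀ x ∈ ExamCurve.equilibria θ, ExamCurve.ParetoPreferred θ lo x := fun x hx =>
      ExamCurve.paretoPreferred_of_classMean_le hlo hx (div_le_div_of_nonneg_right
        (Finset.sum_le_sum fun j _ => hdown (hsu hx) j) n.cast_nonneg)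
    refine ⟨lo, hi, ⟨hlo, fun x hx => hdown (hsu hx)⟩, ⟨hhi, fun x hx => hup (hsu hx)⟩,
      fun x hx y hy => (le_total (ExamCurve.classMean x) (ExamCurve.classMean y)).imp
        (ExamCurve.paretoPreferred_of_classMean_le hx hy)
        (ExamCurve.paretoPreferred_of_classMean_le hy hx),
      fun x hx => ⟨hpar x hx, fun ⟨i, hi'⟩ => ⟨hpar x hx, i, ?_⟩⟩,
      ⟨hrat hlo, fun x hx => hdown (hratsu hx)⟩, ⟨hrat hhi, fun x hx => hup (hratsu hx)⟩,
      ⟨hsu hlo, hdown⟩, ⟨hsu hhi, hup⟩, hhit, hlot⟩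
    -- The student for whom `x i` is no best reply to `lo` gains strictly: `lo i` beats `x i`
    -- against `lo`, where `x i` already earns at least its payoff under `x`.
    have hlt := ExamCurve.payoff_lt_of_notMem_bestResponses (hx i).1 hi' (hlo i)
    rw [Function.update_eq_self, ExamCurve.payoff_update] at hlt
    rw [ExamCurve.payoff_eq_reducedPayoff θ i x]
    exact (ExamCurve.reducedPayoff_mono_slack (θ.ability_mem i).1.le (hx i).1
      (ExamCurve.slack_le_slack le_rfl fun j _ => hdown (hsu hx) j)).trans_lt hlt
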